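/- Let $H$ be a complex Hilbert space and let $T$ be a bounded linear operator on $H$. For $n\ge 0$ let $H^{\otimes n}$ be the $n$-fold Hilbert tensor product of $H$, i.e. the completion of the algebraic tensor power for the inner product determined by $\langle f_1\otimes\cdots\otimes f_n,\,g_1\otimes\cdots\otimes g_n\rangle=\prod_{j=1}^n\langle f_j,g_j\rangle$ (so $H^{\otimes 0}=\mathbb C$), and let $T^{\otimes n}$ be the bounded operator on $H^{\otimes n}$ determined by $T^{\otimes n}(h_1\otimes\cdots\otimes h_n)=Th_1\otimes\cdots\otimes Th_n$ (so $T^{\otimes 0}=I$). Let $H^{\odot n}$ be the closed subspace of $H^{\otimes n}$ spanned by the symmetric tensors $\sum_{\pi\in S_n}h_{\pi(1)}\otimes\cdots\otimes h_{\pi(n)}$ with $h_1,\dots,h_n\in H$, where $S_n$ is the group of permutations of $\{1,\dots,n\}$. It is invariant under $T^{\otimes n}$; let $T^{\odot n}$ be the restriction of $T^{\otimes n}$ to $H^{\odot n}$. Then for every integer $n\ge 0$ $$\sigma(T^{\odot n})=\sigma(T^{\otimes n})=\Bigl\{\prod_{j=1}^n\lambda_j:\ \lambda_j\in\sigma(T),\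 j=1,\dots,n\Bigr\},$$ where $\sigma$ denotes the spectrum of a bounded operator and the empty product (for $n=0$) is $1$. -/

import Mathlib

noncomputable section

namespace HilbertTensor

open scoped TensorProduct ComplexConjugate ComplexOrder

variable {H : Type*} [NormedAddCommGroup H] [InnerProductSpace ℂ H] {n : ℕ}

/-! ### The algebraic tensor power as a pre-Hilbert space -/

/-- The algebraic `n`-fold tensor power of `H` over `ℂ`. It is a type synonym of Mathlib's
`⨂[ℂ] _ : Fin n, H`, because the latter already carries another norm (the projective one). -/
def AlgPower (H : Type*) [NormedAddCommGroup H] [InnerProductSpace ℂ H] (n : ℕ) : Type _ :=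
  ⨂[ℂ] _ : Fin n, H

instance : AddCommGroup (AlgPower H n) := inferInstanceAs (AddCommGroup (⨂[ℂ] _ : Fin n, H))

instance : Module ℂ (AlgPower H n) := inferInstanceAs (Module ℂ (⨂[ℂ] _ : Fin n, H))

/-- The pure tensor `f 0 ⊗ ⋯ ⊗ f (n - 1)`, as a multilinear map into the algebraic tensor power. -/
def algTprod (H : Type*) [NormedAddCommGroup H] [InnerProductSpace ℂ H] (n : ℕ) :
    MultilinearMap ℂ (fun _ : Fin n => H) (AlgPower H n) :=
  PiTensorProduct.tprod ℂ

/-- The universal property of the algebraic tensor power. -/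
def algLift {E : Type*} [AddCommMonoid E] [Module ℂ E]
    (φ : MultilinearMap ℂ (fun _ : Fin n => H) E) : AlgPower H n →ₗ[ℂ] E :=
  PiTensorProduct.lift φ

@[simp] theorem algLift_tprod {E : Type*} [AddCommMonoid E] [Module ℂ E]
    (φ : MultilinearMap ℂ (fun _ : Fin n => H) E) (f : Fin n → H) :
    algLift φ (algTprod H n f) = φ f :=
  PiTensorProduct.lift.tprod f

theorem algPower_ext {E : Type*} [AddCommMonoid E] [Module ℂ E] {φ ψ : AlgPower H n →ₗ[ℂ] E}
    (h : ∀ f, φ (algTprod H n f) = ψ (algTprod H n f)) : φ = ψ :=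
  PiTensorProduct.ext (MultilinearMap.ext h)

theorem exists_eq_sum (x : AlgPower H n) :
    ∃ c : (Fin n → H) →₀ ℂ, (c.sum fun f a => a • algTprod H n f) = x := by
  have hx : x ∈ Submodule.span ℂ (Set.range (algTprod H n)) := by
    have h := PiTensorProduct.span_tprod_eq_top (R := ℂ) (s := fun _ : Fin n => H)
    change (x : ⨂[ℂ] _ : Fin n, H) ∈ Submodule.span ℂ (Set.range (PiTensorProduct.tprod ℂ))
    rw [h]
    trivial
  exact Finsupp.mem_span_range_iff_exists_finsupp.1 hx

/-- The linear form on the algebraic tensor power with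
`g 0 ⊗ ⋯ ⊗ g (n - 1) ↦ ∏ j, ⟪f j, g j⟫`. -/
def innerLeft (f : Fin n → H) : AlgPower H n →ₗ[ℂ] ℂ :=
  algLift ((MultilinearMap.mkPiAlgebra ℂ (Fin n) ℂ).compLinearMap fun j => innerₛₗ ℂ (f j))

@[simp] theorem innerLeft_tprod (f g : Fin n → H) :
    innerLeft f (algTprod H n g) = ∏ j, inner ℂ (f j) (g j) := by
  simp [innerLeft]

theorem innerLeft_update_add [DecidableEq (Fin n)] (f : Fin n → H) (i : Fin n) (a b : H) :
    innerLeft (Function.update f i (a + b)) =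
      innerLeft (Function.update f i a) + innerLeft (Function.update f i b) := by
  refine algPower_ext fun g => ?_
  simp only [innerLeft_tprod, LinearMap.add_apply]
  rw [← Finset.mul_prod_erase _ _ (Finset.mem_univ i),
    ← Finset.mul_prod_erase _ _ (Finset.mem_univ i),
    ← Finset.mul_prod_erase _ _ (Finset.mem_univ i)]
  have h : ∀ c : H, ∏ j ∈ Finset.univ.erase i, inner ℂ (Function.update f i c j) (g j) =
      ∏ j ∈ Finset.univ.erase i, inner ℂ (f j) (g j) := fun c =>
    Finset.prod_congr rfl fun j hj => by rw [Function.update_of_ne (Finset.ne_of_mem_erase hj)]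
  simp only [h, Function.update_self, inner_add_left, add_mul]

theorem innerLeft_update_smul [DecidableEq (Fin n)] (f : Fin n → H) (i : Fin n) (r : ℂ) (a : H) :
    innerLeft (Function.update f i (r • a)) = conj r • innerLeft (Function.update f i a) := by
  refine algPower_ext fun g => ?_
  simp only [innerLeft_tprod, LinearMap.smul_apply]
  rw [← Finset.mul_prod_erase _ _ (Finset.mem_univ i),
    ← Finset.mul_prod_erase _ _ (Finset.mem_univ i)]
  have h : ∀ c : H, ∏ j ∈ Finset.univ.erase i, inner ℂ (Function.update f i c j) (g j) =
      ∏ j ∈ Finset.univ.erase i, inner ℂ (f j) (g j) := fun c =>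
    Finset.prod_congr rfl fun j hj => by rw [Function.update_of_ne (Finset.ne_of_mem_erase hj)]
  simp only [h, Function.update_self, inner_smul_left, smul_eq_mul, mul_assoc]

/-- For fixed `y`, the multilinear map `f ↦ conj ⟪f 0 ⊗ ⋯ ⊗ f (n - 1), y⟫`. -/
def innerRight (y : AlgPower H n) : MultilinearMap ℂ (fun _ : Fin n => H) ℂ where
  toFun f := conj (innerLeft f y)
  map_update_add' f i a b := by simp [innerLeft_update_add]
  map_update_smul' f i r a := by simp [innerLeft_update_smul]

/-- The inner product of the algebraic tensor power: the sesquilinear form (conjugate-linear in the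
first variable) that is determined by
`⟪f 0 ⊗ ⋯ ⊗ f (n - 1), g 0 ⊗ ⋯ ⊗ g (n - 1)⟫ = ∏ j, ⟪f j, g j⟫`. -/
def algInner (x y : AlgPower H n) : ℂ := conj (algLift (innerRight y) x)

theorem algInner_tprod_left (f : Fin n → H) (y : AlgPower H n) :
    algInner (algTprod H n f) y = innerLeft f y := by
  simp [algInner, innerRight]

theorem algInner_tprod_tprod (f g : Fin n → H) :
    algInner (algTprod H n f) (algTprod H n g) = ∏ j, inner ℂ (f j) (g j) := by
  rw [algInner_tprod_left, innerLeft_tprod]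

theorem algInner_sum_sum (F G : (Fin n → H) → AlgPower H n) (c d : (Fin n → H) →₀ ℂ)
    (k : (Fin n → H) → (Fin n → H) → ℂ) (hF : ∀ f, ∃ f', F f = algTprod H n f')
    (hk : ∀ f g, algInner (F f) (G g) = k f g) :
    algInner (c.sum fun f a => a • F f) (d.sum fun g b => b • G g) =
      c.sum fun f a => d.sum fun g b => conj a * k f g * b := by
  simp only [Finsupp.sum]
  unfold algInner
  simp only [map_sum, map_smul, smul_eq_mul, map_mul]
  refine Finset.sum_congr rfl fun f _ => ?_
  obtain ⟨f', hf'⟩ := hF f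
  have h : conj (algLift (innerRight (∑ g ∈ d.support, d g • G g)) (F f)) =
      ∑ g ∈ d.support, d g * k f g := by
    have h1 := algInner_tprod_left f' (∑ g ∈ d.support, d g • G g)
    rw [← hf'] at h1
    unfold algInner at h1
    rw [h1, map_sum]
    refine Finset.sum_congr rfl fun g _ => ?_
    rw [map_smul, smul_eq_mul, ← hk f g, hf', algInner_tprod_left]
  rw [h, Finset.mul_sum]
  exact Finset.sum_congr rfl fun g _ => by ring

/-! ### Positivity and boundedness, by the Schur product theorem -/

theorem inner_self_eq_ofReal {E : Type*} [SeminormedAddCommGroup E] [InnerProductSpace ℂ E]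
    (x : E) : inner ℂ x x = ((‖x‖ ^ 2 : ℝ) : ℂ) := by
  rw [inner_self_eq_norm_sq_to_K]
  simp

theorem posSemidef_kernel {ι : Type*} (u : ι → H) :
    (Matrix.of fun i j => inner ℂ (u i) (u j) : Matrix ι ι ℂ).PosSemidef := by
  refine ⟨Matrix.ext fun i j => by simp, fun c => ?_⟩
  have h : (c.sum fun i a => c.sum fun j b => star a * (Matrix.of fun i j =>
      inner ℂ (u i) (u j) : Matrix ι ι ℂ) i j * b) =
      inner ℂ (c.sum fun i a => a • u i) (c.sum fun i a => a • u i) := by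
    simp only [Finsupp.sum, sum_inner, inner_sum, inner_smul_left, inner_smul_right,
      Finset.mul_sum]
    rw [Finset.sum_comm]
    refine Finset.sum_congr rfl fun i _ => Finset.sum_congr rfl fun j _ => ?_
    simp only [Matrix.of_apply, RCLike.star_def]
    ring
  rw [h, inner_self_eq_ofReal]
  exact Complex.zero_le_real.2 (sq_nonneg _)

theorem posSemidef_prod {ι κ : Type*} (A : κ → Matrix ι ι ℂ) (hA : ∀ j, (A j).PosSemidef)
    (s : Finset κ) : (Matrix.of fun a b => ∏ j ∈ s, A j a b : Matrix ι ι ℂ).PosSemidef := by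
  classical
  induction s using Finset.induction_on with
  | empty =>
    have h := posSemidef_kernel (H := ℂ) (fun _ : ι => (1 : ℂ))
    simpa using h
  | insert j s hj ih =>
    have h := (hA j).hadamard ih
    have e : (Matrix.of fun a b => ∏ i ∈ insert j s, A i a b : Matrix ι ι ℂ) =
        (A j).hadamard (Matrix.of fun a b => ∏ i ∈ s, A i a b) := by
      ext a b
      simp [Finset.prod_insert hj]
    rw [e]
    exact h

theorem posSemidef_smul_prod_sub_prod {ι κ : Type*} (A B : κ → Matrix ι ι ℂ) (r : κ → ℝ)
    (hr : ∀ j, 0 ≤ r j) (hA : ∀ j, (A j).PosSemidef) (hB : ∀ j, (B j).PosSemidef)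
    (hAB : ∀ j, ((r j : ℂ) • A j - B j).PosSemidef) (s : Finset κ) :
    (Matrix.of fun a b => (∏ j ∈ s, (r j : ℂ)) * ∏ j ∈ s, A j a b - ∏ j ∈ s, B j a b :
      Matrix ι ι ℂ).PosSemidef := by
  classical
  induction s using Finset.induction_on with
  | empty =>
    have h : (0 : Matrix ι ι ℂ).PosSemidef := Matrix.PosSemidef.zero
    have e : (Matrix.of fun a b => (∏ i ∈ (∅ : Finset κ), (r i : ℂ)) * ∏ i ∈ (∅ : Finset κ),
        A i a b - ∏ i ∈ (∅ : Finset κ), B i a b : Matrix ι ι ℂ) = 0 := by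
      ext a b
      simp
    rw [e]
    exact h
  | insert j s hj ih =>
    have hc : (0 : ℂ) ≤ ∏ j ∈ s, (r j : ℂ) := by
      rw [← Complex.ofReal_prod]
      exact_mod_cast Finset.prod_nonneg fun j _ => hr j
    have h1 := (hAB j).hadamard ((posSemidef_prod A hA s).smul hc)
    have h2 := (hB j).hadamard ih
    have e : (Matrix.of fun a b => (∏ i ∈ insert j s, (r i : ℂ)) * ∏ i ∈ insert j s, A i a b -
        ∏ i ∈ insert j s, B i a b : Matrix ι ι ℂ) =
        ((r j : ℂ) • A j - B j).hadamard
          ((∏ i ∈ s, (r i : ℂ)) • (Matrix.of fun a b => ∏ i ∈ s, A i a b)) +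
        (B j).hadamard (Matrix.of fun a b => (∏ i ∈ s, (r i : ℂ)) * ∏ i ∈ s, A i a b -
          ∏ i ∈ s, B i a b) := by
      ext a b
      simp [Finset.prod_insert hj]
      ring
    rw [e]
    exact h1.add h2

theorem algInner_self_nonneg (x : AlgPower H n) : 0 ≤ algInner x x := by
  obtain ⟨c, rfl⟩ := exists_eq_sum x
  rw [algInner_sum_sum _ _ c c _ (fun f => ⟨f, rfl⟩) algInner_tprod_tprod]
  exact (posSemidef_prod
    (fun j : Fin n => (Matrix.of fun f g : Fin n → H => inner ℂ (f j) (g j)))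
    (fun j => posSemidef_kernel fun f : Fin n → H => f j) Finset.univ).2 c

/-- The inner product space structure of the algebraic tensor power. (Definiteness is not needed:
the completion below identifies points at distance zero.) -/
abbrev preCore : PreInnerProductSpace.Core ℂ (AlgPower H n) where
  inner := algInner
  conj_inner_symm x y := by
    obtain ⟨c, rfl⟩ := exists_eq_sum x
    obtain ⟨d, rfl⟩ := exists_eq_sum y
    rw [algInner_sum_sum _ _ d c _ (fun f => ⟨f, rfl⟩) algInner_tprod_tprod,
      algInner_sum_sum _ _ c d _ (fun f => ⟨f, rfl⟩) algInner_tprod_tprod]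
    simp only [Finsupp.sum, map_sum, map_mul, map_prod, RCLike.conj_conj]
    rw [Finset.sum_comm]
    refine Finset.sum_congr rfl fun f _ => Finset.sum_congr rfl fun g _ => ?_
    simp only [inner_conj_symm]
    ring
  re_inner_nonneg x := (RCLike.nonneg_iff.1 (algInner_self_nonneg x)).1
  add_left x y z := by simp [algInner]
  smul_left x y r := by simp [algInner]

instance : SeminormedAddCommGroup (AlgPower H n) :=
  InnerProductSpace.Core.toSeminormedAddCommGroup (c := preCore)

instance : InnerProductSpace ℂ (AlgPower H n) := InnerProductSpace.ofCore preCore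

theorem inner_algTprod (f g : Fin n → H) :
    inner ℂ (algTprod H n f) (algTprod H n g) = ∏ j, inner ℂ (f j) (g j) :=
  algInner_tprod_tprod f g

/-- `T ⊗ ⋯ ⊗ T` on the algebraic tensor power. -/
def algMap (T : H →L[ℂ] H) (n : ℕ) : AlgPower H n →ₗ[ℂ] AlgPower H n :=
  algLift ((algTprod H n).compLinearMap fun _ => T.toLinearMap)

@[simp] theorem algMap_tprod (T : H →L[ℂ] H) (f : Fin n → H) :
    algMap T n (algTprod H n f) = algTprod H n fun j => T (f j) := by
  simp [algMap]

theorem norm_algMap_le (T : H →L[ℂ] H) (x : AlgPower H n) :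
    ‖algMap T n x‖ ≤ ‖T‖ ^ n * ‖x‖ := by
  obtain ⟨c, hc⟩ := exists_eq_sum x
  have hTx : algMap T n x = c.sum fun f a => a • algTprod H n fun j => T (f j) := by
    rw [← hc]
    simp [Finsupp.sum, map_sum]
  have key := (posSemidef_smul_prod_sub_prod
    (fun j : Fin n => (Matrix.of fun f g : Fin n → H => inner ℂ (f j) (g j)))
    (fun j : Fin n => (Matrix.of fun f g : Fin n → H => inner ℂ (T (f j)) (T (g j))))
    (fun _ => ‖T‖ ^ 2) (fun _ => by positivity)
    (fun j => posSemidef_kernel fun f : Fin n → H => f j)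
    (fun j => posSemidef_kernel fun f : Fin n → H => T (f j))
    (fun j => by
      refine ⟨Matrix.ext fun f g => by simp, fun d => ?_⟩
      have h : (d.sum fun f a => d.sum fun g b => star a *
          (((‖T‖ ^ 2 : ℝ) : ℂ) • (Matrix.of fun f g : Fin n → H => inner ℂ (f j) (g j)) -
            (Matrix.of fun f g : Fin n → H => inner ℂ (T (f j)) (T (g j))) :
            Matrix (Fin n → H) (Fin n → H) ℂ) f g * b) =
          ((‖T‖ ^ 2 : ℝ) : ℂ) * inner ℂ (d.sum fun f a => a • f j) (d.sum fun f a => a • f j) -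
          inner ℂ (T (d.sum fun f a => a • f j)) (T (d.sum fun f a => a • f j)) := by
        simp only [Finsupp.sum, map_sum, map_smul, sum_inner, inner_sum, inner_smul_left,
          inner_smul_right, Finset.mul_sum, ← Finset.sum_sub_distrib]
        rw [Finset.sum_comm]
        refine Finset.sum_congr rfl fun f _ => Finset.sum_congr rfl fun g _ => ?_
        simp only [Matrix.sub_apply, Matrix.smul_apply, Matrix.of_apply, RCLike.star_def,
          smul_eq_mul]
        ring
      rw [h, inner_self_eq_ofReal, inner_self_eq_ofReal, ← Complex.ofReal_mul,
        ← Complex.ofReal_sub]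
      have h2 : ‖T (d.sum fun f a => a • f j)‖ ^ 2 ≤
          ‖T‖ ^ 2 * ‖d.sum fun f a => a • f j‖ ^ 2 := by
        rw [← mul_pow]
        exact pow_le_pow_left₀ (norm_nonneg _) (T.le_opNorm _) 2
      have h3 := sub_nonneg.2 h2
      exact Complex.zero_le_real.2 h3) Finset.univ).2 c
  have e1 : inner ℂ x x = c.sum fun f a => c.sum fun g b =>
      conj a * (∏ j, inner ℂ (f j) (g j)) * b := by
    rw [← hc]
    exact algInner_sum_sum _ _ c c _ (fun f => ⟨f, rfl⟩) algInner_tprod_tprod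
  have e2 : inner ℂ (algMap T n x) (algMap T n x) = c.sum fun f a => c.sum fun g b =>
      conj a * (∏ j, inner ℂ (T (f j)) (T (g j))) * b := by
    rw [hTx]
    exact algInner_sum_sum _ _ c c _ (fun f => ⟨_, rfl⟩) fun f g => algInner_tprod_tprod _ _
  have e3 : (((‖T‖ ^ n) ^ 2 : ℝ) : ℂ) * inner ℂ x x -
      inner ℂ (algMap T n x) (algMap T n x) = c.sum fun f a => c.sum fun g b => star a *
      (Matrix.of fun f g : Fin n → H => (∏ _j : Fin n, ((‖T‖ ^ 2 : ℝ) : ℂ)) *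
        ∏ j, (Matrix.of fun f g : Fin n → H => inner ℂ (f j) (g j)) f g -
        ∏ j, (Matrix.of fun f g : Fin n → H => inner ℂ (T (f j)) (T (g j))) f g :
        Matrix (Fin n → H) (Fin n → H) ℂ) f g * b := by
    rw [e1, e2]
    simp only [Finsupp.sum, Finset.mul_sum, ← Finset.sum_sub_distrib]
    refine Finset.sum_congr rfl fun f _ => Finset.sum_congr rfl fun g _ => ?_
    simp only [Matrix.of_apply, RCLike.star_def, Finset.prod_const, Finset.card_univ,
      Fintype.card_fin]
    push_cast
    ring
  rw [← e3, inner_self_eq_ofReal, inner_self_eq_ofReal, ← Complex.ofReal_mul,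
    ← Complex.ofReal_sub] at key
  have h4 : 0 ≤ (‖T‖ ^ n) ^ 2 * ‖x‖ ^ 2 - ‖algMap T n x‖ ^ 2 := 
    Complex.zero_le_real.1 key
  refine le_of_sq_le_sq ?_ (by positivity)
  rw [mul_pow]
  linarith

/-! ### Hilbert tensor powers and symmetric tensor powers -/

/-- The `n`-fold Hilbert tensor product `H^{⊗n}`: the completion of the algebraic tensor power. For
`n = 0` it is one-dimensional, spanned by the empty tensor, that is, a copy of `ℂ`. -/
abbrev Power (H : Type*) [NormedAddCommGroup H] [InnerProductSpace ℂ H] (n : ℕ) : Type _ :=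
  UniformSpace.Completion (AlgPower H n)

/-- The pure tensor `f 0 ⊗ ⋯ ⊗ f (n - 1)` in `H^{⊗n}`. -/
def pureTensor (f : Fin n → H) : Power H n := ((algTprod H n f : AlgPower H n) : Power H n)

theorem inner_pureTensor (f g : Fin n → H) :
    inner ℂ (pureTensor f) (pureTensor g) = ∏ j, inner ℂ (f j) (g j) := by
  simp [pureTensor, inner_algTprod]

/-- `T^{⊗n}`: the bounded extension of `T ⊗ ⋯ ⊗ T` to `H^{⊗n}`. -/
def opPower (T : H →L[ℂ] H) (n : ℕ) : Power H n →L[ℂ] Power H n :=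
  ((algMap T n).mkContinuous (‖T‖ ^ n) (norm_algMap_le T)).completion

@[simp] theorem opPower_pureTensor (T : H →L[ℂ] H) (f : Fin n → H) :
    opPower T n (pureTensor f) = pureTensor fun j => T (f j) := by
  simp [opPower, pureTensor, ContinuousLinearMap.completion_apply_coe]

/-- The elementary symmetric tensor `∑ σ ∈ S_n, f (σ 0) ⊗ ⋯ ⊗ f (σ (n - 1))`. -/
def symTprod (f : Fin n → H) : Power H n := ∑ σ : Equiv.Perm (Fin n), pureTensor fun j => f (σ j)

/-- The symmetric tensor power `H^{⊙n}`: the closed subspace of `H^{⊗n}` spanned by the symmetric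
tensors. -/
def symPower (H : Type*) [NormedAddCommGroup H] [InnerProductSpace ℂ H] (n : ℕ) :
    Submodule ℂ (Power H n) :=
  (Submodule.span ℂ (Set.range (symTprod (H := H) (n := n)))).topologicalClosure

theorem opPower_mem_symPower (T : H →L[ℂ] H) (n : ℕ) :
    ∀ x ∈ symPower H n, opPower T n x ∈ symPower H n := by
  have h : Submodule.span ℂ (Set.range (symTprod (H := H) (n := n))) ≤
      (symPower H n).comap (opPower T n).toLinearMap := by
    refine Submodule.span_le.2 ?_
    rintro _ ⟨f, rfl⟩
    have hf : opPower T n (symTprod f) = symTprod fun j => T (f j) := by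
      simp [symTprod, map_sum]
    change opPower T n (symTprod f) ∈ symPower H n
    rw [hf]
    exact Submodule.le_topologicalClosure _ (Submodule.subset_span ⟨_, rfl⟩)
  have hc : IsClosed ((symPower H n).comap (opPower T n).toLinearMap : Set (Power H n)) :=
    (Submodule.isClosed_topologicalClosure _).preimage (opPower T n).continuous
  exact fun x hx => Submodule.topologicalClosure_minimal _ h hc hx

/-- `T^{⊙n}`: the restriction of `T^{⊗n}` to the invariant subspace `H^{⊙n}`. -/
def symOpPower (T : H →L[ℂ] H) (n : ℕ) : symPower H n →L[ℂ] symPower H n :=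
  (opPower T n).restrict (opPower_mem_symPower T n)

end HilbertTensor

end

noncomputable section

namespace HilbertTensor

open scoped ComplexConjugate ComplexOrder

/-! ### Moving products of points of a compact set to its frontier -/

/-! The three sets form a cycle of inclusions: σ(T^{⊙n}) ⊆ σ(T^{⊗n}) ⊆ products ⊆ σ(T^{⊙n}).

Every spectral value `z` of a Hilbert space operator is an approximate eigenvalue, or `conj z` is
one of the adjoint. Approximate eigenvectors of T^{⊙n} serve T^{⊗n} as well, and taking adjoints
commutes with both powers; this gives the first inclusion. For the second, T^{⊗n} is the product of
the commuting operators I ⊗ ⋯ ⊗ T ⊗ ⋯ ⊗ I, whose spectra lie in σ(T), and Gelfand theory splits a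
spectral value of such a product.

The third inclusion is the hard one. If all the λ_j are approximate eigenvalues of T, symmetrized
products of approximate eigenvectors work, since symmetrization cannot make them small
(`exists_le_norm_symTprod`); if all the conjugates are approximate eigenvalues of T*, the adjoint is
used. A mixed family is first modified without changing its product (`exists_prod_eq_forall_mem`):
multiplying one factor by e^s and another by e^{-s} pushes one of them to the frontier of σ(T),
where both alternatives hold. -/

/-- Take the largest s ≥ 0 with e^s a and e^{-s} b both in `K`. It exists because `K` is compact and
`a ≠ 0`; if both points were interior, s could be increased. -/
theorem exists_mul_eq_mem_frontier {K : Set ℂ} (hK : IsCompact K) {a b : ℂ} (ha : a ∈ K)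
    (hb : b ∈ K) (ha0 : a ≠ 0) :
    ∃ a' ∈ K, ∃ b' ∈ K, a' * b' = a * b ∧ (a' ∈ frontier K ∨ b' ∈ frontier K) := by
  set p : ℝ → ℂ := fun s => (Real.exp s : ℂ) * a
  set q : ℝ → ℂ := fun s => (Real.exp (-s) : ℂ) * b
  have hp : Continuous p := by fun_prop
  have hq : Continuous q := by fun_prop
  set S : Set ℝ := Set.Ici 0 ∩ (p ⁻¹' K ∩ q ⁻¹' K)
  have hS : IsClosed S :=
    isClosed_Ici.inter ((hK.isClosed.preimage hp).inter (hK.isClosed.preimage hq))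
  have h0 : (0 : ℝ) ∈ S := by simp [S, p, q, ha, hb]
  obtain ⟨R, hR⟩ := hK.isBounded.exists_norm_le
  have hbdd : BddAbove S := by
    refine ⟨R / ‖a‖, fun s hs => ?_⟩
    have h1 := hR _ hs.2.1
    simp only [p, norm_mul, Complex.norm_real, Real.norm_eq_abs, Real.abs_exp] at h1
    have ha' : 0 < ‖a‖ := norm_pos_iff.2 ha0
    rw [le_div_iff₀ ha']
    nlinarith [Real.add_one_le_exp s]
  have hm : sSup S ∈ S := hS.csSup_mem ⟨0, h0⟩ hbdd
  set m := sSup S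
  refine ⟨p m, hm.2.1, q m, hm.2.2, ?_, ?_⟩
  · have h : (Real.exp m : ℂ) * (Real.exp (-m) : ℂ) = 1 := by
      rw [← Complex.ofReal_mul, ← Real.exp_add]
      simp
    calc p m * q m = ((Real.exp m : ℂ) * (Real.exp (-m) : ℂ)) * (a * b) := by
          simp only [p, q]; ring
      _ = a * b := by rw [h, one_mul]
  · by_contra! h
    have e1 : ∀ᶠ s in nhds m, p s ∈ K :=
      hp.continuousAt.eventually_mem (mem_interior_iff_mem_nhds.1 (by
        by_contra h'
        exact h.1 ⟨subset_closure hm.2.1, h'⟩))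
    have e2 : ∀ᶠ s in nhds m, q s ∈ K :=
      hq.continuousAt.eventually_mem (mem_interior_iff_mem_nhds.1 (by
        by_contra h'
        exact h.2 ⟨subset_closure hm.2.2, h'⟩))
    obtain ⟨ε, hε, H⟩ := Metric.eventually_nhds_iff.1 (e1.and e2)
    have hmem : m + ε / 2 ∈ S := by
      have := H (y := m + ε / 2) (by
        rw [Real.dist_eq, add_sub_cancel_left, abs_of_pos (by positivity)]
        linarith)
      exact ⟨by have := hm.1; simp only [Set.mem_Ici] at this ⊢; positivity, this⟩
    have := le_csSup hbdd hmem
    linarith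

theorem prod_update_update {ι : Type*} [Fintype ι] [DecidableEq ι] (l : ι → ℂ) {i j : ι}
    (hij : i ≠ j) {a b : ℂ} (h : a * b = l i * l j) :
    ∏ k, Function.update (Function.update l i a) j b k = ∏ k, l k := by
  have key : ∀ a b : ℂ, ∏ k, Function.update (Function.update l i a) j b k =
      a * b * ∏ k ∈ (Finset.univ \ {j}) \ {i}, l k := fun a b => by
    rw [Finset.prod_update_of_mem (Finset.mem_univ j),
      Finset.prod_update_of_mem (by simp [hij])]
    ring
  have h2 : Function.update (Function.update l i (l i)) j (l j) = l := by simp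
  rw [key, h, ← key, h2]

theorem exists_prod_eq_forall_mem {ι : Type*} [Fintype ι] {K A B : Set ℂ} (hK : IsCompact K)
    (hAB : K ⊆ A ∪ B) (hf : frontier K ⊆ A ∩ B) (l : ι → ℂ) (hl : ∀ j, l j ∈ K) :
    ∃ l' : ι → ℂ, ∏ j, l' j = ∏ j, l j ∧ ((∀ j, l' j ∈ A) ∨ ∀ j, l' j ∈ B) := by
  classical
  by_cases hz : ∃ j, l j = 0
  · obtain ⟨j, hj⟩ := hz
    -- A zero factor makes the product zero, so the constant family 0 will do; 0 lies in `K`, hence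
    -- in `A` or in `B`.
    refine ⟨fun _ => 0, ?_, ?_⟩
    · rw [Finset.prod_eq_zero (Finset.mem_univ j) hj, Finset.prod_eq_zero (Finset.mem_univ j) rfl]
    · exact (hAB (hj ▸ hl j)).imp (fun h _ => h) (fun h _ => h)
  push Not at hz
  -- A move changes one factor outside `A` and one outside `B`, both counted here, and puts at least
  -- one of them in `A ∩ B`, so the count drops.
  induction hc : (Finset.univ.filter fun j => l j ∉ A ∩ B).card using Nat.strong_induction_on
    generalizing l with
  | _ N ih =>
    by_cases hA : ∀ j, l j ∈ A
    · exact ⟨l, rfl, Or.inl hA⟩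
    by_cases hB : ∀ j, l j ∈ B
    · exact ⟨l, rfl, Or.inr hB⟩
    push Not at hA hB
    obtain ⟨i, hi⟩ := hA
    obtain ⟨j, hj⟩ := hB
    have hij : i ≠ j := by
      rintro rfl
      exact (hAB (hl i)).elim hi hj
    obtain ⟨a, ha, b, hb, hab, hfr⟩ := exists_mul_eq_mem_frontier hK (hl i) (hl j) (hz i)
    have hab0 : a * b ≠ 0 := hab ▸ mul_ne_zero (hz i) (hz j)
    have hprod := prod_update_update l hij hab
    set l' := Function.update (Function.update l i a) j b
    have hi' : l' i = a := by simp [l', hij]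
    have hj' : l' j = b := by simp [l']
    have hk' : ∀ k, k ≠ i → k ≠ j → l' k = l k := fun k h1 h2 => by simp [l', h1, h2]
    have hall : ∀ P : ℂ → Prop, P a → P b → (∀ k, P (l k)) → ∀ k, P (l' k) := by
      intro P h1 h2 h3 k
      by_cases e1 : k = i
      · rwa [e1, hi']
      by_cases e2 : k = j
      · rwa [e2, hj']
      rw [hk' k e1 e2]
      exact h3 k
    rw [← hprod]
    refine ih _ ?_ l' (hall (· ∈ K) ha hb hl)
      (hall (· ≠ 0) (left_ne_zero_of_mul hab0) (right_ne_zero_of_mul hab0) hz) rfl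
    rw [← hc]
    refine Finset.card_lt_card ((Finset.ssubset_iff_of_subset fun k hk => ?_).2 ?_)
    · simp only [Finset.mem_filter, Finset.mem_univ, true_and] at hk ⊢
      by_cases e1 : k = i
      · exact fun h => hi (e1 ▸ h.1)
      by_cases e2 : k = j
      · exact fun h => hj (e2 ▸ h.2)
      rwa [← hk' k e1 e2]
    · rcases hfr with h | h
      · exact ⟨i, by simp [hi], by simpa [hi'] using hf h⟩
      · exact ⟨j, by simp [hj], by simpa [hj'] using hf h⟩

/-! ### The approximate point spectrum -/

section ApproxSpectrum

variable {E : Type*} [NormedAddCommGroup E] [InnerProductSpace ℂ E]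

/-- The approximate point spectrum of a bounded operator. -/
def approxSpectrum (T : E →L[ℂ] E) : Set ℂ :=
  {z | ∀ ε : ℝ, 0 < ε → ∃ x, x ≠ 0 ∧ ‖T x - z • x‖ ≤ ε * ‖x‖}

theorem exists_norm_eq_one_of_mem_approxSpectrum {T : E →L[ℂ] E} {z : ℂ}
    (hz : z ∈ approxSpectrum T) {ε : ℝ} (hε : 0 < ε) : ∃ x, ‖x‖ = 1 ∧ ‖T x - z • x‖ ≤ ε := by
  obtain ⟨x, hx0, hx⟩ := hz ε hε
  have hx' : 0 < ‖x‖ := norm_pos_iff.2 hx0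
  refine ⟨((‖x‖⁻¹ : ℝ) : ℂ) • x, ?_, ?_⟩
  · rw [norm_smul, Complex.norm_real, norm_inv, norm_norm, inv_mul_cancel₀ hx'.ne']
  · rw [map_smul, smul_comm z, ← smul_sub, norm_smul, Complex.norm_real, norm_inv, norm_norm,
      inv_mul_le_iff₀ hx', mul_comm]
    exact hx

theorem exists_le_norm_of_notMem_approxSpectrum {T : E →L[ℂ] E} {z : ℂ}
    (hz : z ∉ approxSpectrum T) : ∃ c : ℝ, 0 < c ∧ ∀ x, c * ‖x‖ ≤ ‖T x - z • x‖ := by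
  simp only [approxSpectrum, Set.mem_ofPred_eq] at hz
  push Not at hz
  obtain ⟨c, hc, h⟩ := hz
  refine ⟨c, hc, fun x => ?_⟩
  by_cases hx : x = 0
  · simp [hx]
  · exact (h x hx).le

theorem algebraMap_sub_apply (T : E →L[ℂ] E) (z : ℂ) (x : E) :
    (algebraMap ℂ (E →L[ℂ] E) z - T) x = z • x - T x := by
  simp [Algebra.algebraMap_eq_smul_one]

theorem approxSpectrum_subset_spectrum (T : E →L[ℂ] E) : approxSpectrum T ⊆ spectrum ℂ T := by
  intro z hz hu
  obtain ⟨u, hu⟩ := hu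
  set S : E →L[ℂ] E := ↑u⁻¹
  have hS : ∀ x, S (z • x - T x) = x := fun x => by
    rw [← algebraMap_sub_apply, ← hu]
    exact congrArg (fun A : E →L[ℂ] E => A x) u.inv_mul
  -- This tolerance times `‖S‖` is at most 1/2, which contradicts `‖x‖ ≤ ‖S‖ * ‖T x - z • x‖`.
  obtain ⟨x, hx0, hx⟩ := hz (1 / (2 * (‖S‖ + 1))) (by positivity)
  have hx' : 0 < ‖x‖ := norm_pos_iff.2 hx0
  have h1 : ‖x‖ ≤ ‖S‖ * ‖T x - z • x‖ := by
    rw [norm_sub_rev]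
    simpa [hS] using S.le_opNorm (z • x - T x)
  have h2 : ‖S‖ * ‖T x - z • x‖ ≤ ‖S‖ * (1 / (2 * (‖S‖ + 1)) * ‖x‖) := by gcongr
  have h3 : ‖S‖ * (1 / (2 * (‖S‖ + 1)) * ‖x‖) = (‖S‖ / (‖S‖ + 1)) * (‖x‖ / 2) := by
    field_simp
  have h4 : ‖S‖ / (‖S‖ + 1) ≤ 1 := by
    rw [div_le_one (by positivity)]
    linarith
  nlinarith

variable [CompleteSpace E]

/-- Bounded below means injective with closed range; a trivial orthogonal complement makes the range
dense. -/
theorem isUnit_of_le_norm {A : E →L[ℂ] E} {c : ℝ} (hc : 0 < c) (h : ∀ x, c * ‖x‖ ≤ ‖A x‖)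
    (h' : ∀ v, (∀ x, inner ℂ v (A x) = 0) → v = 0) : IsUnit A := by
  rw [ContinuousLinearMap.isUnit_iff_bijective,
    ContinuousLinearMap.bijective_iff_dense_range_and_antilipschitz]
  refine ⟨?_, ⟨c.toNNReal⁻¹, A.antilipschitz_of_bound fun x => ?_⟩⟩
  · rw [Submodule.topologicalClosure_eq_top_iff, Submodule.eq_bot_iff]
    intro v hv
    refine h' v fun x => ?_
    exact (Submodule.mem_orthogonal' _ v).1 hv _ ⟨x, rfl⟩
  · rw [NNReal.coe_inv, Real.coe_toNNReal _ hc.le, le_inv_mul_iff₀ hc]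
    exact h x

/-- A vector orthogonal to the range of `z - T` is an eigenvector of the adjoint for `conj z`, or
zero. -/
theorem mem_approxSpectrum_or_of_mem_spectrum {T : E →L[ℂ] E} {z : ℂ} (hz : z ∈ spectrum ℂ T) :
    z ∈ approxSpectrum T ∨ conj z ∈ approxSpectrum (ContinuousLinearMap.adjoint T) := by
  by_contra! h
  obtain ⟨c, hc, h1⟩ := exists_le_norm_of_notMem_approxSpectrum h.1
  obtain ⟨d, hd, h2⟩ := exists_le_norm_of_notMem_approxSpectrum h.2
  refine hz (isUnit_of_le_norm hc (fun x => ?_) fun v hv => ?_)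
  · rw [algebraMap_sub_apply, norm_sub_rev]
    exact h1 x
  · have h3 : ContinuousLinearMap.adjoint T v - conj z • v = 0 := by
      refine ext_inner_right ℂ fun x => ?_
      have := hv x
      rw [algebraMap_sub_apply, inner_sub_right, inner_smul_right] at this
      rw [inner_sub_left, inner_smul_left, ContinuousLinearMap.adjoint_inner_left,
        RCLike.conj_conj, inner_zero_left]
      linear_combination -this
    have h4 := h2 v
    rw [h3, norm_zero] at h4
    exact norm_le_zero_iff.1 (nonpos_of_mul_nonpos_right h4 hd)

theorem frontier_spectrum_subset_approxSpectrum (T : E →L[ℂ] E) :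
    frontier (spectrum ℂ T) ⊆ approxSpectrum T := by
  intro z hz
  by_contra h
  obtain ⟨c, hc, h1⟩ := exists_le_norm_of_notMem_approxSpectrum h
  have hz1 : z ∈ spectrum ℂ T := (spectrum.isClosed T).frontier_subset hz
  rw [frontier_eq_closure_inter_closure] at hz
  -- For `v` orthogonal to the range of `z - T`, write `v = (w - T) u`. Orthogonality gives `‖v‖ ≤
  -- ‖z - w‖ * ‖u‖`, hence `c * ‖u‖ ≤ ‖T u - z • u‖ ≤ 2 * ‖z - w‖ * ‖u‖`, impossible within radius
  -- `c / 2` unless `v = 0`.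
  obtain ⟨w, hw, hwz⟩ := Metric.mem_closure_iff.1 hz.2 (c / 2) (by positivity)
  rw [dist_eq_norm] at hwz
  have hw' : IsUnit (algebraMap ℂ (E →L[ℂ] E) w - T) := by
    by_contra h'
    exact hw h'
  have hsurj := (ContinuousLinearMap.isUnit_iff_bijective.1 hw').2
  refine hz1 (isUnit_of_le_norm hc (fun x => ?_) fun v hv => ?_)
  · rw [algebraMap_sub_apply, norm_sub_rev]
    exact h1 x
  · obtain ⟨u, hu⟩ := hsurj v
    rw [algebraMap_sub_apply] at hu
    have e0 := hv u
    rw [algebraMap_sub_apply] at e0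
    have e1 : inner ℂ v v = inner ℂ v ((w - z) • u) := by
      have : v = (z • u - T u) + (w - z) • u := by rw [← hu, sub_smul]; abel
      conv_lhs => rw [this, inner_add_right, ← this, e0, zero_add]
    have e2 : ‖v‖ * ‖v‖ ≤ ‖v‖ * (‖z - w‖ * ‖u‖) := by
      calc ‖v‖ * ‖v‖ = ‖inner ℂ v v‖ := by rw [inner_self_eq_norm_sq_to_K]; simp [sq]
        _ ≤ ‖v‖ * ‖(w - z) • u‖ := e1 ▸ norm_inner_le_norm _ _
        _ = _ := by rw [norm_smul, norm_sub_rev]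
    by_contra hv0
    have e3 : ‖v‖ ≤ ‖z - w‖ * ‖u‖ := le_of_mul_le_mul_left e2 (norm_pos_iff.2 hv0)
    have e4 : ‖T u - z • u‖ ≤ ‖v‖ + ‖z - w‖ * ‖u‖ := by
      have : T u - z • u = -v + -((z - w) • u) := by rw [← hu, sub_smul]; abel
      rw [this, ← norm_smul, ← norm_neg v, ← norm_neg ((z - w) • u)]
      exact norm_add_le _ _
    have e5 := h1 u
    have hu0 : 0 < ‖u‖ := by
      rw [norm_pos_iff]
      rintro rfl
      apply hv0
      rw [← hu]
      simp
    nlinarith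

theorem spectrum_adjoint (T : E →L[ℂ] E) :
    spectrum ℂ (ContinuousLinearMap.adjoint T) = star (spectrum ℂ T) :=
  spectrum.map_star T

theorem conj_mem_spectrum_adjoint {T : E →L[ℂ] E} {z : ℂ} :
    conj z ∈ spectrum ℂ (ContinuousLinearMap.adjoint T) ↔ z ∈ spectrum ℂ T := by
  rw [spectrum_adjoint, Set.mem_star, RCLike.star_def, RCLike.conj_conj]

theorem conj_mem_frontier_spectrum_adjoint {T : E →L[ℂ] E} {z : ℂ}
    (hz : z ∈ frontier (spectrum ℂ T)) :
    conj z ∈ frontier (spectrum ℂ (ContinuousLinearMap.adjoint T)) := by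
  have h := Complex.conjLIE.toHomeomorph.preimage_frontier
    (spectrum ℂ (ContinuousLinearMap.adjoint T))
  have h2 : Complex.conjLIE.toHomeomorph ⁻¹' (spectrum ℂ (ContinuousLinearMap.adjoint T)) =
      spectrum ℂ T := Set.ext fun w => conj_mem_spectrum_adjoint
  rw [h2] at h
  rw [← h] at hz
  exact hz

end ApproxSpectrum

/-! ### The spectrum of a product of commuting elements -/

theorem exists_mem_spectrum_of_mem_spectrum_noncommProd {A ι : Type*} [NormedRing A]
    [NormedAlgebra ℂ A] [CompleteSpace A] (s : Finset ι) (a : ι → A)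
    (ha : ∀ i j, a i * a j = a j * a i) {z : ℂ}
    (hz : z ∈ spectrum ℂ (s.noncommProd a fun i _ j _ _ => ha i j)) :
    ∃ l : ι → ℂ, (∀ i, l i ∈ spectrum ℂ (a i)) ∧ z = ∏ i ∈ s, l i := by
  set C : Set A := (Set.range a).centralizer
  -- The bicommutant of the family is commutative, closed and stable under inverses, so spectra
  -- computed in it agree with those in `A` and are the values of characters.
  set B : Subalgebra ℂ A := Subalgebra.centralizer ℂ C
  have hC : ∀ x ∈ Set.range a, ∀ y ∈ Set.range a, x * y = y * x := by
    rintro _ ⟨i, rfl⟩ _ ⟨j, rfl⟩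
    exact ha i j
  have hBC : ∀ x ∈ B, x ∈ C := fun x hx =>
    Set.centralizer_subset (fun y hy z hz => hC z hz y hy) hx
  let _ : NormedCommRing B :=
    { (inferInstance : NormedRing B) with
      mul_comm := fun x y => Subtype.ext (y.2 x (hBC x x.2)) }
  have : CompleteSpace B := (Set.isClosed_centralizer C).completeSpace_coe
  have hunit : ∀ x : B, IsUnit (x : A) → IsUnit x := by
    rintro x ⟨u, hu⟩
    have hmem : (↑u⁻¹ : A) ∈ B := fun y hy => by
      have h : y * ↑u = ↑u * y := by rw [hu]; exact x.2 y hy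
      exact ((show Commute y (u : A) from h).units_inv_right).eq
    exact ⟨⟨x, ⟨_, hmem⟩, Subtype.ext (by simp [← hu]), Subtype.ext (by simp [← hu])⟩, rfl⟩
  have hspec : ∀ x : B, spectrum ℂ x = spectrum ℂ (x : A) := fun x => by
    ext w
    refine not_congr ⟨fun h => ?_, fun h => hunit _ h⟩
    exact h.map B.val
  set b : ι → B := fun i => ⟨a i, Set.subset_centralizer_centralizer ⟨i, rfl⟩⟩
  have hprod : ((∏ i ∈ s, b i : B) : A) = s.noncommProd a fun i _ j _ _ => ha i j := by
    rw [← Finset.noncommProd_eq_prod]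
    exact Finset.map_noncommProd s b _ B.val
  rw [← hprod, ← hspec, WeakDual.CharacterSpace.mem_spectrum_iff_exists] at hz
  obtain ⟨f, hf⟩ := hz
  refine ⟨fun i => f (b i), fun i => ?_, ?_⟩
  · have : f (b i) ∈ spectrum ℂ (b i) := WeakDual.CharacterSpace.mem_spectrum_iff_exists.2 ⟨f, rfl⟩
    rwa [hspec] at this
  · rw [← hf, map_prod]

variable {H : Type*} [NormedAddCommGroup H] [InnerProductSpace ℂ H] {n : ℕ}

/-! ### Pure and symmetric tensors -/

/-- The pure tensor as a multilinear map into the Hilbert tensor power. -/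
def pureTensorMultilinear (H : Type*) [NormedAddCommGroup H] [InnerProductSpace ℂ H] (n : ℕ) :
    MultilinearMap ℂ (fun _ : Fin n => H) (Power H n) :=
  (UniformSpace.Completion.toComplL (𝕜 := ℂ) (E := AlgPower H n)).toLinearMap.compMultilinearMap
    (algTprod H n)

theorem pureTensorMultilinear_apply (f : Fin n → H) :
    pureTensorMultilinear H n f = pureTensor f := rfl

theorem norm_pureTensor (f : Fin n → H) : ‖pureTensor f‖ = ∏ j, ‖f j‖ := by
  have h := inner_pureTensor f f
  simp only [inner_self_eq_ofReal] at h
  rw [← Complex.ofReal_prod, Complex.ofReal_inj, Finset.prod_pow] at h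
  exact (pow_left_inj₀ (norm_nonneg _) (Finset.prod_nonneg fun _ _ => norm_nonneg _)
    two_ne_zero).1 h

theorem pureTensor_smul (l : Fin n → ℂ) (f : Fin n → H) :
    pureTensor (fun j => l j • f j) = (∏ j, l j) • pureTensor f :=
  (pureTensorMultilinear H n).map_smul_univ l f

theorem norm_pureTensor_sub_le {f g : Fin n → H} {M ε : ℝ} (hM : 0 ≤ M) (hε : 0 ≤ ε)
    (hf : ∀ j, ‖f j‖ ≤ M) (hg : ∀ j, ‖g j‖ ≤ M) (hfg : ∀ j, ‖f j - g j‖ ≤ ε) :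
    ‖pureTensor f - pureTensor g‖ ≤ n * M ^ (n - 1) * ε := by
  have h := (pureTensorMultilinear H n).norm_image_sub_le_of_bound zero_le_one
    (fun m => by rw [one_mul, pureTensorMultilinear_apply, norm_pureTensor]) f g
  rw [Fintype.card_fin, one_mul] at h
  refine h.trans ?_
  have h1 : max ‖f‖ ‖g‖ ≤ M :=
    max_le ((pi_norm_le_iff_of_nonneg hM).2 hf) ((pi_norm_le_iff_of_nonneg hM).2 hg)
  have h2 : ‖f - g‖ ≤ ε := (pi_norm_le_iff_of_nonneg hε).2 hfg
  gcongr

theorem power_hom_ext {E : Type*} [NormedAddCommGroup E] [NormedSpace ℂ E]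
    {φ ψ : Power H n →L[ℂ] E} (h : ∀ f, φ (pureTensor f) = ψ (pureTensor f)) : φ = ψ := by
  have h1 : φ.toLinearMap ∘ₗ (UniformSpace.Completion.toComplL (𝕜 := ℂ)).toLinearMap =
      ψ.toLinearMap ∘ₗ (UniformSpace.Completion.toComplL (𝕜 := ℂ)).toLinearMap :=
    algPower_ext h
  refine ContinuousLinearMap.ext fun x => ?_
  induction x using UniformSpace.Completion.induction_on with
  | hp => exact isClosed_eq φ.continuous ψ.continuous
  | ih x => exact LinearMap.congr_fun h1 x

theorem opPower_symTprod (T : H →L[ℂ] H) (f : Fin n → H) :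
    opPower T n (symTprod f) = symTprod fun j => T (f j) := by
  simp [symTprod, map_sum]

theorem symTprod_smul (l : Fin n → ℂ) (f : Fin n → H) :
    symTprod (fun j => l j • f j) = (∏ j, l j) • symTprod f := by
  simp only [symTprod, Finset.smul_sum]
  refine Finset.sum_congr rfl fun σ _ => ?_
  rw [pureTensor_smul (fun j => l (σ j)), Equiv.prod_comp σ l]

theorem norm_symTprod_sub_le {f g : Fin n → H} {M ε : ℝ} (hM : 0 ≤ M) (hε : 0 ≤ ε)
    (hf : ∀ j, ‖f j‖ ≤ M) (hg : ∀ j, ‖g j‖ ≤ M) (hfg : ∀ j, ‖f j - g j‖ ≤ ε) :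
    ‖symTprod f - symTprod g‖ ≤ n.factorial * (n * M ^ (n - 1) * ε) := by
  rw [symTprod, symTprod, ← Finset.sum_sub_distrib]
  refine (norm_sum_le_of_le _ fun σ _ => norm_pureTensor_sub_le hM hε (fun j => hf (σ j))
    (fun j => hg (σ j)) fun j => hfg (σ j)).trans ?_
  simp [Fintype.card_perm]

theorem symTprod_mem_symPower (f : Fin n → H) : symTprod f ∈ symPower H n :=
  Submodule.le_topologicalClosure _ (Submodule.subset_span ⟨f, rfl⟩)

/-! ### A uniform lower bound for symmetric tensors -/

theorem inner_pureTensor_const_symTprod (y : H) (f : Fin n → H) :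
    inner ℂ (pureTensor fun _ : Fin n => y) (symTprod f) =
      n.factorial * ∏ j, inner ℂ y (f j) := by
  rw [symTprod, inner_sum, Finset.sum_congr rfl fun σ _ => ?_, Finset.sum_const,
    Finset.card_univ, Fintype.card_perm, Fintype.card_fin, nsmul_eq_mul]
  rw [inner_pureTensor]
  exact Equiv.prod_comp σ fun j => inner ℂ y (f j)

/-- Induction on `n`. If `y` is nearly orthogonal to the new unit vector `x`, replace it by `y + (c
/ 2) • x`: the product with `x` becomes at least c/2 - c/4, the others stay at least c - c/2. The
bound `c ≤ 1` controls the growth of `‖y‖`. -/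
theorem exists_le_norm_inner (H : Type*) [NormedAddCommGroup H] [InnerProductSpace ℂ H] (n : ℕ) :
    ∃ c : ℝ, 0 < c ∧ c ≤ 1 ∧ ∀ f : Fin n → H, (∀ j, ‖f j‖ = 1) →
      ∃ y : H, ‖y‖ ≤ n ∧ ∀ j, c ≤ ‖inner ℂ y (f j)‖ := by
  induction n with
  | zero => exact ⟨1, one_pos, le_rfl, fun f _ => ⟨0, by simp, fun j => j.elim0⟩⟩
  | succ n ih =>
    obtain ⟨c, hc, hc1, h⟩ := ih
    refine ⟨c / 4, by positivity, by linarith, fun f hf => ?_⟩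
    obtain ⟨y, hy, hyf⟩ := h (fun j => f j.castSucc) fun j => hf _
    set x := f (Fin.last n)
    have hx : ‖x‖ = 1 := hf _
    have hxx : inner ℂ x x = (1 : ℂ) := by rw [inner_self_eq_ofReal, hx]; simp
    by_cases hs : c / 4 ≤ ‖inner ℂ y x‖
    · refine ⟨y, by push_cast; linarith, fun j => ?_⟩
      induction j using Fin.lastCases with
      | last => exact hs
      | cast j => exact le_trans (by linarith) (hyf j)
    · refine ⟨y + ((c / 2 : ℝ) : ℂ) • x, ?_, fun j => ?_⟩
      · refine (norm_add_le _ _).trans ?_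
        rw [norm_smul, hx, Complex.norm_real, Real.norm_of_nonneg (by positivity)]
        push_cast
        linarith
      · rw [inner_add_left, inner_smul_left, Complex.conj_ofReal]
        push Not at hs
        induction j using Fin.lastCases with
        | last =>
          have h1 := norm_sub_le (inner ℂ y x + ((c / 2 : ℝ) : ℂ) * inner ℂ x x) (inner ℂ y x)
          rw [add_sub_cancel_left, hxx, mul_one, Complex.norm_real,
            Real.norm_of_nonneg (by positivity)] at h1
          change c / 4 ≤ ‖inner ℂ y x + ((c / 2 : ℝ) : ℂ) * inner ℂ x x‖
          rw [hxx, mul_one]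
          linarith
        | cast j =>
          have h1 := norm_sub_le (inner ℂ y (f j.castSucc) +
            ((c / 2 : ℝ) : ℂ) * inner ℂ x (f j.castSucc))
            (((c / 2 : ℝ) : ℂ) * inner ℂ x (f j.castSucc))
          rw [add_sub_cancel_right, norm_mul, Complex.norm_real,
            Real.norm_of_nonneg (by positivity : 0 ≤ c / 2)] at h1
          have h2 := norm_inner_le_norm (𝕜 := ℂ) x (f j.castSucc)
          rw [hx, hf, one_mul] at h2
          have h3 := hyf j
          nlinarith

/-- Pairing with y ⊗ ⋯ ⊗ y gives the same value on every permuted term, so nothing cancels. -/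
theorem exists_le_norm_symTprod (H : Type*) [NormedAddCommGroup H] [InnerProductSpace ℂ H]
    (n : ℕ) : ∃ c : ℝ, 0 < c ∧ ∀ f : Fin n → H, (∀ j, ‖f j‖ = 1) → c ≤ ‖symTprod f‖ := by
  obtain ⟨c, hc, -, h⟩ := exists_le_norm_inner H n
  refine ⟨c ^ n / ((n : ℝ) + 1) ^ n, by positivity, fun f hf => ?_⟩
  obtain ⟨y, hy, hyf⟩ := h f hf
  rw [div_le_iff₀ (by positivity)]
  have h1 := norm_inner_le_norm (𝕜 := ℂ) (pureTensor fun _ : Fin n => y) (symTprod f)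
  rw [inner_pureTensor_const_symTprod, norm_pureTensor, norm_mul, norm_prod, Finset.prod_const,
    Finset.card_univ, Fintype.card_fin, Complex.norm_natCast] at h1
  have h2 : c ^ n ≤ ∏ j, ‖inner ℂ y (f j)‖ := by
    have := Finset.prod_le_prod (s := Finset.univ) (fun _ _ => hc.le) fun j _ => hyf j
    simpa using this
  have h3 : (1 : ℝ) ≤ n.factorial := by exact_mod_cast Nat.one_le_iff_ne_zero.2 n.factorial_ne_zero
  have h4 : ‖y‖ ^ n ≤ ((n : ℝ) + 1) ^ n := pow_le_pow_left₀ (norm_nonneg _) (by linarith) n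
  calc c ^ n ≤ ∏ j, ‖inner ℂ y (f j)‖ := h2
    _ ≤ n.factorial * ∏ j, ‖inner ℂ y (f j)‖ :=
      le_mul_of_one_le_left (Finset.prod_nonneg fun _ _ => norm_nonneg _) h3
    _ ≤ ‖y‖ ^ n * ‖symTprod f‖ := h1
    _ ≤ ‖symTprod f‖ * ((n : ℝ) + 1) ^ n := by rw [mul_comm]; gcongr

theorem prod_mem_approxSpectrum_symOpPower {T : H →L[ℂ] H} {l : Fin n → ℂ}
    (hl : ∀ j, l j ∈ approxSpectrum T) : ∏ j, l j ∈ approxSpectrum (symOpPower T n) := by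
  intro ε hε
  obtain ⟨c, hc, hlow⟩ := exists_le_norm_symTprod H n
  set M := max ‖T‖ ‖l‖
  have hM : 0 ≤ M := (norm_nonneg T).trans (le_max_left _ _)
  set D : ℝ := n.factorial * (n * M ^ (n - 1))
  have hD : 0 ≤ D := by positivity
  -- The total error is at most `D * δ ≤ ε * c ≤ ε * ‖symTprod f‖`. Since `f` is chosen after `δ`,
  -- it matters that `c` does not depend on `f`.
  set δ : ℝ := ε * c / (D + 1)
  have hδ : 0 < δ := by positivity
  choose f hf1 hf using fun j => exists_norm_eq_one_of_mem_approxSpectrum (hl j) hδ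
  have hc' := hlow f hf1
  refine ⟨⟨symTprod f, symTprod_mem_symPower f⟩, fun h => ?_, ?_⟩
  · rw [Subtype.ext_iff] at h
    change symTprod f = 0 at h
    rw [h, norm_zero] at hc'
    linarith
  · change ‖opPower T n (symTprod f) - (∏ j, l j) • symTprod f‖ ≤ ε * ‖symTprod f‖
    rw [opPower_symTprod, ← symTprod_smul]
    refine (norm_symTprod_sub_le hM hδ.le (fun j => ?_) (fun j => ?_) hf).trans ?_
    · have := T.le_opNorm (f j)
      rw [hf1, mul_one] at this
      exact this.trans (le_max_left _ _)
    · rw [norm_smul, hf1, mul_one]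
      exact (norm_le_pi_norm l j).trans (le_max_right _ _)
    · calc (n.factorial : ℝ) * (n * M ^ (n - 1) * δ) = D / (D + 1) * (ε * c) := by
            simp only [D, δ]; ring
        _ ≤ 1 * (ε * c) := by
          gcongr
          rw [div_le_one (by positivity)]
          linarith
        _ ≤ ε * ‖symTprod f‖ := by rw [one_mul]; gcongr

/-! ### Adjoints -/

theorem approxSpectrum_symOpPower_subset (T : H →L[ℂ] H) (n : ℕ) :
    approxSpectrum (symOpPower T n) ⊆ approxSpectrum (opPower T n) := by
  intro z hz ε hε
  obtain ⟨x, hx0, hx⟩ := hz ε hε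
  exact ⟨x, fun h => hx0 (Subtype.ext h), hx⟩

instance : CompleteSpace (symPower H n) :=
  (Submodule.isClosed_topologicalClosure _).completeSpace_coe

theorem adjoint_opPower [CompleteSpace H] (T : H →L[ℂ] H) (n : ℕ) :
    ContinuousLinearMap.adjoint (opPower T n) = opPower (ContinuousLinearMap.adjoint T) n := by
  refine power_hom_ext fun f => ext_inner_right ℂ fun y => ?_
  have h : innerSL ℂ (ContinuousLinearMap.adjoint (opPower T n) (pureTensor f)) =
      innerSL ℂ (opPower (ContinuousLinearMap.adjoint T) n (pureTensor f)) := by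
    refine power_hom_ext fun g => ?_
    simp only [innerSL_apply_apply, ContinuousLinearMap.adjoint_inner_left, opPower_pureTensor,
      inner_pureTensor]
  exact congrArg (fun φ : Power H n →L[ℂ] ℂ => φ y) h

/-- The symmetric subspace is invariant under T^{⊗n} and under its adjoint, so restriction commutes
with the adjoint. -/
theorem adjoint_symOpPower [CompleteSpace H] (T : H →L[ℂ] H) (n : ℕ) :
    ContinuousLinearMap.adjoint (symOpPower T n) =
      symOpPower (ContinuousLinearMap.adjoint T) n := by
  symm
  rw [ContinuousLinearMap.eq_adjoint_iff]
  intro x y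
  change inner ℂ (opPower (ContinuousLinearMap.adjoint T) n x) (y : Power H n) =
    inner ℂ (x : Power H n) (opPower T n y)
  rw [← adjoint_opPower, ContinuousLinearMap.adjoint_inner_left]

/-! ### The inclusions that involve the spectrum of the symmetric power -/

theorem spectrum_symOpPower_subset [CompleteSpace H] (T : H →L[ℂ] H) (n : ℕ) :
    spectrum ℂ (symOpPower T n) ⊆ spectrum ℂ (opPower T n) := by
  intro z hz
  rcases mem_approxSpectrum_or_of_mem_spectrum hz with h | h
  · exact approxSpectrum_subset_spectrum _ (approxSpectrum_symOpPower_subset T n h)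
  · rw [adjoint_symOpPower] at h
    rw [← conj_mem_spectrum_adjoint, adjoint_opPower]
    exact approxSpectrum_subset_spectrum _ (approxSpectrum_symOpPower_subset _ n h)

theorem prod_mem_spectrum_symOpPower [CompleteSpace H] (T : H →L[ℂ] H) (l : Fin n → ℂ)
    (hl : ∀ j, l j ∈ spectrum ℂ T) : ∏ j, l j ∈ spectrum ℂ (symOpPower T n) := by
  obtain ⟨l', hl', h⟩ := exists_prod_eq_forall_mem (spectrum.isCompact T)
    (A := approxSpectrum T)
    (B := {z | conj z ∈ approxSpectrum (ContinuousLinearMap.adjoint T)})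
    (fun z hz => mem_approxSpectrum_or_of_mem_spectrum hz)
    (fun z hz => ⟨frontier_spectrum_subset_approxSpectrum T hz,
      frontier_spectrum_subset_approxSpectrum _ (conj_mem_frontier_spectrum_adjoint hz)⟩) l hl
  rw [← hl']
  rcases h with h | h
  · exact approxSpectrum_subset_spectrum _ (prod_mem_approxSpectrum_symOpPower h)
  · rw [← conj_mem_spectrum_adjoint, adjoint_symOpPower, map_prod]
    exact approxSpectrum_subset_spectrum _ (prod_mem_approxSpectrum_symOpPower h)

/-! ### Tensor products of different operators -/

/-- `A 0 ⊗ ⋯ ⊗ A (n - 1)` on the algebraic tensor power. -/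
def algMapFamily (A : Fin n → H →L[ℂ] H) : AlgPower H n →ₗ[ℂ] AlgPower H n :=
  algLift ((algTprod H n).compLinearMap fun j => (A j).toLinearMap)

@[simp] theorem algMapFamily_tprod (A : Fin n → H →L[ℂ] H) (f : Fin n → H) :
    algMapFamily A (algTprod H n f) = algTprod H n fun j => A j (f j) := by
  simp [algMapFamily]

theorem posSemidef_norm_sq_smul_sub {ι : Type*} (A : H →L[ℂ] H) (u : ι → H) :
    (((‖A‖ ^ 2 : ℝ) : ℂ) • (Matrix.of fun i j => inner ℂ (u i) (u j)) -
      (Matrix.of fun i j => inner ℂ (A (u i)) (A (u j))) : Matrix ι ι ℂ).PosSemidef := by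
  refine ⟨Matrix.ext fun i j => by simp, fun d => ?_⟩
  have h : (d.sum fun i a => d.sum fun j b => star a *
      (((‖A‖ ^ 2 : ℝ) : ℂ) • (Matrix.of fun i j => inner ℂ (u i) (u j)) -
        (Matrix.of fun i j => inner ℂ (A (u i)) (A (u j))) : Matrix ι ι ℂ) i j * b) =
      ((‖A‖ ^ 2 : ℝ) : ℂ) * inner ℂ (d.sum fun i a => a • u i) (d.sum fun i a => a • u i) -
      inner ℂ (A (d.sum fun i a => a • u i)) (A (d.sum fun i a => a • u i)) := by
    simp only [Finsupp.sum, map_sum, map_smul, sum_inner, inner_sum, inner_smul_left,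
      inner_smul_right, Finset.mul_sum, ← Finset.sum_sub_distrib]
    rw [Finset.sum_comm]
    refine Finset.sum_congr rfl fun i _ => Finset.sum_congr rfl fun j _ => ?_
    simp only [Matrix.sub_apply, Matrix.smul_apply, Matrix.of_apply, RCLike.star_def, smul_eq_mul]
    ring
  rw [h, inner_self_eq_ofReal, inner_self_eq_ofReal, ← Complex.ofReal_mul, ← Complex.ofReal_sub]
  refine Complex.zero_le_real.2 (sub_nonneg.2 ?_)
  rw [← mul_pow]
  exact pow_le_pow_left₀ (norm_nonneg _) (A.le_opNorm _) 2

/-- Gram matrices of pure tensors are Hadamard products of those of the factors, so the Schur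
product theorem lets the bounds for the single `A j` be multiplied. -/
theorem norm_algMapFamily_le (A : Fin n → H →L[ℂ] H) (x : AlgPower H n) :
    ‖algMapFamily A x‖ ≤ (∏ j, ‖A j‖) * ‖x‖ := by
  obtain ⟨c, hc⟩ := exists_eq_sum x
  have hAx : algMapFamily A x = c.sum fun f a => a • algTprod H n fun j => A j (f j) := by
    rw [← hc]
    simp [Finsupp.sum, map_sum]
  have key := (posSemidef_smul_prod_sub_prod
    (fun j : Fin n => (Matrix.of fun f g : Fin n → H => inner ℂ (f j) (g j)))
    (fun j : Fin n => (Matrix.of fun f g : Fin n → H => inner ℂ (A j (f j)) (A j (g j))))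
    (fun j => ‖A j‖ ^ 2) (fun _ => by positivity)
    (fun j => posSemidef_kernel fun f : Fin n → H => f j)
    (fun j => posSemidef_kernel fun f : Fin n → H => A j (f j))
    (fun j => posSemidef_norm_sq_smul_sub (A j) fun f : Fin n → H => f j) Finset.univ).2 c
  have e1 : inner ℂ x x = c.sum fun f a => c.sum fun g b =>
      conj a * (∏ j, inner ℂ (f j) (g j)) * b := by
    rw [← hc]
    exact algInner_sum_sum _ _ c c _ (fun f => ⟨f, rfl⟩) algInner_tprod_tprod
  have e2 : inner ℂ (algMapFamily A x) (algMapFamily A x) = c.sum fun f a => c.sum fun g b =>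
      conj a * (∏ j, inner ℂ (A j (f j)) (A j (g j))) * b := by
    rw [hAx]
    exact algInner_sum_sum _ _ c c _ (fun f => ⟨_, rfl⟩) fun f g => algInner_tprod_tprod _ _
  have e3 : (((∏ j, ‖A j‖) ^ 2 : ℝ) : ℂ) * inner ℂ x x -
      inner ℂ (algMapFamily A x) (algMapFamily A x) = c.sum fun f a => c.sum fun g b => star a *
      (Matrix.of fun f g : Fin n → H => (∏ j : Fin n, ((‖A j‖ ^ 2 : ℝ) : ℂ)) *
        ∏ j, (Matrix.of fun f g : Fin n → H => inner ℂ (f j) (g j)) f g -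
        ∏ j, (Matrix.of fun f g : Fin n → H => inner ℂ (A j (f j)) (A j (g j))) f g :
        Matrix (Fin n → H) (Fin n → H) ℂ) f g * b := by
    rw [e1, e2]
    simp only [Finsupp.sum, Finset.mul_sum, ← Finset.sum_sub_distrib]
    refine Finset.sum_congr rfl fun f _ => Finset.sum_congr rfl fun g _ => ?_
    simp only [Matrix.of_apply, RCLike.star_def, ← Finset.prod_pow]
    push_cast
    ring
  rw [← e3, inner_self_eq_ofReal, inner_self_eq_ofReal, ← Complex.ofReal_mul,
    ← Complex.ofReal_sub] at key
  have h4 : 0 ≤ (∏ j, ‖A j‖) ^ 2 * ‖x‖ ^ 2 - ‖algMapFamily A x‖ ^ 2 := Complex.zero_le_real.1 key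
  refine le_of_sq_le_sq ?_ (mul_nonneg (Finset.prod_nonneg fun _ _ => norm_nonneg _)
    (norm_nonneg _))
  rw [mul_pow]
  linarith

/-- `A 0 ⊗ ⋯ ⊗ A (n - 1)` on the Hilbert tensor power, multiplicatively in the family `A`. -/
def opFamily (H : Type*) [NormedAddCommGroup H] [InnerProductSpace ℂ H] (n : ℕ) :
    (Fin n → H →L[ℂ] H) →* (Power H n →L[ℂ] Power H n) :=
  have h (A : Fin n → H →L[ℂ] H) (f : Fin n → H) :
      ((algMapFamily A).mkContinuous _ (norm_algMapFamily_le A)).completion (pureTensor f) =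
        pureTensor fun j => A j (f j) := by
    simp [pureTensor, ContinuousLinearMap.completion_apply_coe]
  { toFun := fun A => ((algMapFamily A).mkContinuous _ (norm_algMapFamily_le A)).completion
    map_one' := power_hom_ext fun f => by rw [h]; rfl
    map_mul' := fun A B => power_hom_ext fun f => by
      rw [mul_apply_eq_comp, h, h, h]; rfl }

@[simp] theorem opFamily_pureTensor (A : Fin n → H →L[ℂ] H) (f : Fin n → H) :
    opFamily H n A (pureTensor f) = pureTensor fun j => A j (f j) := by
  simp [opFamily, pureTensor, ContinuousLinearMap.completion_apply_coe]

theorem opFamily_const (T : H →L[ℂ] H) : opFamily H n (fun _ => T) = opPower T n :=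
  power_hom_ext fun f => by simp

theorem opFamily_mulSingle_pureTensor (j : Fin n) (A : H →L[ℂ] H) (f : Fin n → H) :
    opFamily H n (Pi.mulSingle j A) (pureTensor f) =
      pureTensorMultilinear H n (Function.update f j (A (f j))) := by
  rw [opFamily_pureTensor, pureTensorMultilinear_apply]
  congr 1
  funext i
  by_cases h : i = j
  · subst h
    simp
  · simp [h]

/-- `opFamily` is only multiplicative; linearity in one slot comes from multilinearity of pure
tensors. Together they carry an inverse of `z - T` to one for the operator acting in slot `j`. -/
theorem opFamily_mulSingle_algebraMap_sub (j : Fin n) (z : ℂ) (T : H →L[ℂ] H) :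
    opFamily H n (Pi.mulSingle j (algebraMap ℂ (H →L[ℂ] H) z - T)) =
      algebraMap ℂ (Power H n →L[ℂ] Power H n) z - opFamily H n (Pi.mulSingle j T) := by
  refine power_hom_ext fun f => ?_
  rw [algebraMap_sub_apply, opFamily_mulSingle_pureTensor, opFamily_mulSingle_pureTensor,
    algebraMap_sub_apply, MultilinearMap.map_update_sub, MultilinearMap.map_update_smul,
    Function.update_eq_self, pureTensorMultilinear_apply]

/-! ### Spectral values of the full tensor power are products -/

theorem spectrum_opFamily_mulSingle_subset (j : Fin n) (T : H →L[ℂ] H) :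
    spectrum ℂ (opFamily H n (Pi.mulSingle j T)) ⊆ spectrum ℂ T := by
  intro z hz hu
  refine hz ?_
  rw [spectrum.mem_resolventSet_iff, ← opFamily_mulSingle_algebraMap_sub]
  exact (spectrum.mem_resolventSet_iff.1 hu).map ((opFamily H n).comp (MonoidHom.mulSingle (fun _ : Fin n => H →L[ℂ] H) j))

theorem exists_prod_eq_of_mem_spectrum_opPower (T : H →L[ℂ] H) {z : ℂ}
    (hz : z ∈ spectrum ℂ (opPower T n)) :
    ∃ l : Fin n → ℂ, (∀ j, l j ∈ spectrum ℂ T) ∧ z = ∏ j, l j := by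
  have hcomm : ∀ i j : Fin n, opFamily H n (Pi.mulSingle i T) * opFamily H n (Pi.mulSingle j T) =
      opFamily H n (Pi.mulSingle j T) * opFamily H n (Pi.mulSingle i T) := fun i j => by
    rw [← map_mul, ← map_mul]
    congr 1
    rcases eq_or_ne i j with rfl | h
    · rfl
    · exact Pi.mulSingle_commute (f := fun _ : Fin n => H →L[ℂ] H) h T T
  have hprod : opPower T n = Finset.univ.noncommProd
      (fun j => opFamily H n (Pi.mulSingle j T)) fun i _ j _ _ => hcomm i j := by
    rw [← opFamily_const, ← Finset.noncommProd_mulSingle (fun _ : Fin n => T)]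
    exact Finset.map_noncommProd _ _ _ _
  rw [hprod] at hz
  obtain ⟨l, hl, h⟩ := exists_mem_spectrum_of_mem_spectrum_noncommProd _ _ hcomm hz
  exact ⟨l, fun j => spectrum_opFamily_mulSingle_subset j T (hl j), h⟩

end HilbertTensor

end

theorem theorem3p3 {H : Type*} [NormedAddCommGroup H] [InnerProductSpace ℂ H] [CompleteSpace H]
    (T : H →L[ℂ] H) (n : ℕ) :
    spectrum ℂ (HilbertTensor.symOpPower T n) = spectrum ℂ (HilbertTensor.opPower T n) ∧
    spectrum ℂ (HilbertTensor.opPower T n) =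
      {z : ℂ | ∃ l : Fin n → ℂ, (∀ j, l j ∈ spectrum ℂ T) ∧ z = ∏ j, l j} := by
  have h1 := HilbertTensor.spectrum_symOpPower_subset T n
  have h2 : spectrum ℂ (HilbertTensor.opPower T n) ⊆
      {z : ℂ | ∃ l : Fin n → ℂ, (∀ j, l j ∈ spectrum ℂ T) ∧ z = ∏ j, l j} :=
    fun z hz => HilbertTensor.exists_prod_eq_of_mem_spectrum_opPower T hz
  have h3 : {z : ℂ | ∃ l : Fin n → ℂ, (∀ j, l j ∈ spectrum ℂ T) ∧ z = ∏ j, l j} ⊆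
      spectrum ℂ (HilbertTensor.symOpPower T n) := by
    rintro _ ⟨l, hl, rfl⟩
    exact HilbertTensor.prod_mem_spectrum_symOpPower T l hl
  exact ⟨h1.antisymm (h2.trans h3), h2.antisymm (h3.trans h1)⟩
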